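/- Let $\mu$ be a Borel probability measure on $\mathbb{R}$, let $T>0$, and let $L_2(T)$ be the space of complex-valued functions on $[0,T]$ that are square integrable for the uniform probability measure on $[0,T]$. For $x\in L_2(\mu)$ put $$[\mathcal{F}_\mu^* x](t)=\int_{\mathbb{R}} x(\xi)e^{2\pi i\xi t}\,d\mu(\xi),\qquad \|x\|_\mu^2=\int_{\mathbb{R}}|x|^2\,d\mu,\qquad \|z\|_T^2=\frac1T\int_0^T|z(t)|^2\,dt .$$ Let $\mathcal{K}_\mu:L_2(T)\to L_2(T)$ be the operator $$[\mathcal{K}_\mu z](t)=\int_{\mathbb{R}} e^{2\pi i\xi t}\Big[\frac1T\int_0^T z(s)e^{-2\pi i\xi s}\,ds\Big]d\mu(\xi),$$ and let $n_{\mu,\epsilon}$ be the number of eigenvalues of $\mathcal{K}_\mu$, counted with multiplicity, that are at least $\epsilon$. Fix $\epsilon>0$, $C\ge1$ and a set $\mathcal{N}$ of noise functions that contains the zero function (for instance all square integrable functions on $[0,T]$, or only the zero function). Consider the following reconstruction problem. An algorithm, which may depend on $\mu,T,\epsilon,C,\mathcal{N}$, has query access to $y+n$, where $y=\mathcal{F}_\mu^*x$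 for an unknown $x\in L_2(\mu)$ and $n\in\mathcal{N}$ is an unknown fixed noise function: it may query the value $y(t)+n(t)$ at any point $t\in[0,T]$ of its choice. It has to output $\tilde y\in L_2(T)$ with $$\|y-\tilde y\|_T^2\le\epsilon\|x\|_\mu^2+C\|n\|_T^2 .$$ The algorithm may be randomized and adaptive: the decision to stop, the next query point and the output are measurable functions of a random seed, drawn from an arbitrary probability space, and of the answers received so far. **Theorem.** Suppose that such an algorithm makes at most $r$ queries on every input (every $x\in L_2(\mu)$, every $n\in\mathcal{N}$ and every value of the seed) and that, for every $x\in L_2(\mu)$ and $n\in\mathcal{N}$, its output satisfies the error guarantee above with probability at least $2/3$. Then $$r\ \ge\ \frac{n_{\mu,72\epsilon}}{20}.$$ -/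

import Mathlib

open MeasureTheory
open scoped ENNReal NNReal

noncomputable section

namespace FourierInterp

/-! # Fourier operators between `L₂` spaces of finite measures on the line -/

/-- `w ↦ ∫ f(v) e^{i σ v w} dα(v)`. -/
def charTransform (σ : ℝ) (α : Measure ℝ) (f : ℝ → ℂ) (w : ℝ) : ℂ :=
  ∫ v, f v * Complex.exp ((σ * v * w : ℝ) * Complex.I) ∂α

theorem charTransform_congr (σ : ℝ) {α : Measure ℝ} {f g : ℝ → ℂ} (h : f =ᵐ[α] g) :
    charTransform σ α f = charTransform σ α g := by
  funext w
  refine integral_congr_ae ?_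
  filter_upwards [h] with v hv
  rw [hv]

theorem norm_charTransform_le (σ : ℝ) (α : Measure ℝ) (f : ℝ → ℂ) (w : ℝ) :
    ‖charTransform σ α f w‖ ≤ ∫ v, ‖f v‖ ∂α := by
  refine (norm_integral_le_integral_norm _).trans (le_of_eq ?_)
  refine integral_congr_ae (Filter.Eventually.of_forall fun v => ?_)
  simp only [norm_mul, Complex.norm_exp_ofReal_mul_I, mul_one]

theorem integrable_charTransform (σ : ℝ) {α : Measure ℝ} {f : ℝ → ℂ} (hf : Integrable f α)
    (w : ℝ) :
    Integrable (fun v => f v * Complex.exp ((σ * v * w : ℝ) * Complex.I)) α := by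
  refine hf.mul_bdd (c := 1) ?_ (Filter.Eventually.of_forall fun v => ?_)
  · exact (Continuous.aestronglyMeasurable (by fun_prop))
  · rw [Complex.norm_exp_ofReal_mul_I]

theorem continuous_charTransform (σ : ℝ) {α : Measure ℝ} {f : ℝ → ℂ} (hf : Integrable f α) :
    Continuous (charTransform σ α f) := by
  refine continuous_of_dominated (bound := fun v => ‖f v‖)
    (fun w => (integrable_charTransform σ hf w).aestronglyMeasurable) (fun w => ?_) hf.norm ?_
  · refine Filter.Eventually.of_forall fun v => ?_
    simp only [norm_mul, Complex.norm_exp_ofReal_mul_I, mul_one, le_refl]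
  · exact Filter.Eventually.of_forall fun v => by fun_prop

theorem memLp_charTransform (σ : ℝ) {α : Measure ℝ} (β : Measure ℝ) [IsFiniteMeasure β]
    {f : ℝ → ℂ} (hf : Integrable f α) : MemLp (charTransform σ α f) 2 β :=
  MemLp.of_bound (continuous_charTransform σ hf).aestronglyMeasurable _
    (Filter.Eventually.of_forall (norm_charTransform_le σ α f))

theorem integrable_Lp {α : Measure ℝ} [IsFiniteMeasure α] (f : Lp ℂ 2 α) :
    Integrable (f : ℝ → ℂ) α :=
  (Lp.memLp f).integrable (by norm_num)

theorem integral_norm_le {α : Measure ℝ} [IsFiniteMeasure α] (f : Lp ℂ 2 α) :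
    ∫ v, ‖f v‖ ∂α ≤ (α Set.univ ^ (1 / 2 : ℝ)).toReal * ‖f‖ := by
  rw [integral_norm_eq_lintegral_enorm (Lp.aestronglyMeasurable f), ← eLpNorm_one_eq_lintegral_enorm,
    Lp.norm_def, mul_comm, ← ENNReal.toReal_mul]
  refine ENNReal.toReal_mono ?_ ?_
  · exact ENNReal.mul_ne_top (Lp.eLpNorm_ne_top f)
      (ENNReal.rpow_ne_top_of_nonneg (by norm_num) (measure_ne_top α _))
  · refine (eLpNorm_le_eLpNorm_mul_rpow_measure_univ (p := 1) (q := 2) (by norm_num)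
      (Lp.aestronglyMeasurable f)).trans (le_of_eq ?_)
    norm_num

/-- The bounded operator `f ↦ (w ↦ ∫ f(v) e^{i σ v w} dα(v))` from `L₂(α)` to `L₂(β)`. -/
def charOperator (σ : ℝ) (α β : Measure ℝ) [IsFiniteMeasure α] [IsFiniteMeasure β] :
    Lp ℂ 2 α →L[ℂ] Lp ℂ 2 β :=
  LinearMap.mkContinuous
    { toFun := fun f => (memLp_charTransform σ β (integrable_Lp f)).toLp (charTransform σ α f)
      map_add' := by
        intro f g
        rw [← MemLp.toLp_add]
        refine MemLp.toLp_congr _ _ (Filter.Eventually.of_forall fun w => ?_)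
        rw [charTransform_congr σ (Lp.coeFn_add f g), Pi.add_apply]
        unfold charTransform
        rw [← integral_add (integrable_charTransform σ (integrable_Lp f) w)
          (integrable_charTransform σ (integrable_Lp g) w)]
        simp only [Pi.add_apply, add_mul]
      map_smul' := by
        intro c f
        rw [RingHom.id_apply, ← MemLp.toLp_const_smul]
        refine MemLp.toLp_congr _ _ (Filter.Eventually.of_forall fun w => ?_)
        rw [charTransform_congr σ (Lp.coeFn_smul c f), Pi.smul_apply]
        unfold charTransform
        rw [← integral_smul]
        simp only [Pi.smul_apply, smul_eq_mul, mul_assoc] }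
    ((measureUnivNNReal β : ℝ) ^ ((2 : ℝ≥0∞).toReal⁻¹) * (α Set.univ ^ (1 / 2 : ℝ)).toReal)
    (by
      intro f
      rw [mul_assoc]
      refine Lp.norm_le_of_ae_bound (mul_nonneg ENNReal.toReal_nonneg (norm_nonneg f)) ?_
      filter_upwards [MemLp.coeFn_toLp (memLp_charTransform σ β (integrable_Lp f))] with w hw
      refine (le_of_eq (congrArg norm hw)).trans ?_
      exact (norm_charTransform_le σ α f w).trans (integral_norm_le f))

/-! # The interpolation problem -/

/-- The uniform probability measure on `[0, T]` (for `T > 0`). -/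
def uniformOn (T : ℝ) : Measure ℝ := (ENNReal.ofReal T)⁻¹ • volume.restrict (Set.Icc 0 T)

instance isFiniteMeasure_uniformOn (T : ℝ) : IsFiniteMeasure (uniformOn T) := by
  constructor
  rw [uniformOn, Measure.smul_apply, Measure.restrict_apply_univ, Real.volume_Icc, sub_zero,
    smul_eq_mul]
  exact ENNReal.inv_mul_le_one (ENNReal.ofReal T) |>.trans_lt ENNReal.one_lt_top

/-- `L₂(T)`: square integrable complex functions for the uniform probability measure on `[0, T]`. -/
abbrev L2T (T : ℝ) : Type := Lp ℂ 2 (uniformOn T)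

/-- The inverse Fourier transform `[ℱ_μ^* g](t) = ∫ g(ξ) e^{2πiξt} dμ(ξ)`, as an everywhere defined
function of `t`. -/
def invFourier (μ : Measure ℝ) (g : ℝ → ℂ) (t : ℝ) : ℂ :=
  charTransform (2 * Real.pi) μ g t

/-- `ℱ_μ : L₂(T) → L₂(μ)`, `[ℱ_μ f](ξ) = (1/T) ∫_0^T f(t) e^{-2πitξ} dt`. -/
def fourierOp (μ : Measure ℝ) [IsFiniteMeasure μ] (T : ℝ) : L2T T →L[ℂ] Lp ℂ 2 μ :=
  charOperator (-(2 * Real.pi)) (uniformOn T) μ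

/-- `ℱ_μ^* : L₂(μ) → L₂(T)`, the operator given by `invFourier`. -/
def invFourierOp (μ : Measure ℝ) [IsFiniteMeasure μ] (T : ℝ) : Lp ℂ 2 μ →L[ℂ] L2T T :=
  charOperator (2 * Real.pi) μ (uniformOn T)

/-- The kernel operator
`[𝒦_μ z](t) = ∫ e^{2πiξt} [(1/T) ∫_0^T z(s) e^{-2πiξs} ds] dμ(ξ)` on `L₂(T)`. -/
def kernelOp (μ : Measure ℝ) [IsFiniteMeasure μ] (T : ℝ) : L2T T →L[ℂ] L2T T :=
  (invFourierOp μ T).comp (fourierOp μ T)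

/-- `n_{μ,ε}`: the number of eigenvalues of `𝒦_μ` that are at least `ε`, counted with multiplicity
(the dimension of the eigenspace). -/
def eigenvalueCount (μ : Measure ℝ) [IsFiniteMeasure μ] (T ε : ℝ) : ℝ≥0∞ :=
  ∑' l : Set.Ici ε, ((Cardinal.toENat (Module.rank ℂ
    (Module.End.eigenspace (kernelOp μ T : L2T T →ₗ[ℂ] L2T T) ((l : ℝ) : ℂ))) : ℕ∞) : ℝ≥0∞)

/-- The energy `∫ |z|² dα`. -/
def energy (α : Measure ℝ) (z : ℝ → ℂ) : ℝ≥0∞ := ∫⁻ v, ‖z v‖ₑ ^ 2 ∂α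

/-- `‖y - ỹ‖_T² ≤ ε ‖x‖_μ² + C ‖n‖_T²`, where `y = ℱ_μ^* x`. -/
def Recovers (μ : Measure ℝ) (T ε C : ℝ) (x : Lp ℂ 2 μ) (n : ℝ → ℂ) (ytilde : L2T T) : Prop :=
  energy (uniformOn T) (fun t => invFourier μ x t - ytilde t) ≤
    ENNReal.ofReal ε * energy μ x + ENNReal.ofReal C * energy (uniformOn T) n

/-! # Randomized adaptive query algorithms -/

/-- A randomized adaptive query algorithm with random seeds in `Ω`. Once the answers to `k` queries
have been received, the seed and these answers determine whether it stops; if it stops, they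
determine the output, and if not, they determine the next query point in `[0, T]`. -/
structure QueryAlgorithm (Ω : Type*) [MeasurableSpace Ω] (T : ℝ) where
  halts : (k : ℕ) → Set (Ω × (Fin k → ℂ))
  query : (k : ℕ) → Ω × (Fin k → ℂ) → Set.Icc (0 : ℝ) T
  output : (k : ℕ) → Ω × (Fin k → ℂ) → L2T T
  measurableSet_halts : ∀ k, MeasurableSet (halts k)
  measurable_query : ∀ k, Measurable (query k)
  measurable_output : ∀ k, Measurable[_, borel (L2T T)] (output k)

namespace QueryAlgorithm

/-- The answers to the first `k` queries for the seed `ω` when the observed signal is `f`. (After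
the algorithm has stopped, the values have no meaning and are not used.) -/
def answers {Ω : Type*} [MeasurableSpace Ω] {T : ℝ} (A : QueryAlgorithm Ω T) (f : ℝ → ℂ) (ω : Ω) :
    (k : ℕ) → Fin k → ℂ
  | 0 => Fin.elim0
  | k + 1 => Fin.snoc (A.answers f ω k) (f (A.query k (ω, A.answers f ω k)))

/-- For the seed `ω` and the observed signal `f`, the algorithm makes exactly `k` queries. -/
def StopsAfter {Ω : Type*} [MeasurableSpace Ω] {T : ℝ} (A : QueryAlgorithm Ω T) (f : ℝ → ℂ) (ω : Ω)
    (k : ℕ) : Prop :=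
  (ω, A.answers f ω k) ∈ A.halts k ∧ ∀ j < k, (ω, A.answers f ω j) ∉ A.halts j

/-- On every input `y + n`, with `y = ℱ_μ^* x`, `x ∈ L₂(μ)` and `n ∈ 𝒩`, and for every seed, the
algorithm stops after at most `r` queries. -/
def MakesAtMost {Ω : Type*} [MeasurableSpace Ω] {T : ℝ} (A : QueryAlgorithm Ω T) (μ : Measure ℝ)
    (𝒩 : Set (ℝ → ℂ)) (r : ℕ) : Prop :=
  ∀ x : Lp ℂ 2 μ, ∀ n ∈ 𝒩, ∀ ω : Ω, ∃ k ≤ r, A.StopsAfter (fun t => invFourier μ x t + n t) ω k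

/-- On every input `y + n`, with `y = ℱ_μ^* x`, `x ∈ L₂(μ)` and `n ∈ 𝒩`, the algorithm stops with
an output satisfying the error guarantee with probability at least `p`. -/
def SolvesWithProb {Ω : Type*} [MeasurableSpace Ω] {T : ℝ} (A : QueryAlgorithm Ω T) (P : Measure Ω)
    (μ : Measure ℝ) (ε C : ℝ) (𝒩 : Set (ℝ → ℂ)) (p : ℝ≥0∞) : Prop :=
  ∀ x : Lp ℂ 2 μ, ∀ n ∈ 𝒩, p ≤ P {ω | ∃ k,
    A.StopsAfter (fun t => invFourier μ x t + n t) ω k ∧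
    Recovers μ T ε C x n
      (A.output k (ω, A.answers (fun t => invFourier μ x t + n t) ω k))}

end QueryAlgorithm

end FourierInterp

end

noncomputable section

/-! If more than `20 * r` eigenvalues are at least `72 * ε`, there are `N = 20 * r + 1` orthonormal
eigenvectors. Their normalized images in `L₂(μ)` are orthonormal, so coefficients `c ∈ ℂ^N` give
inputs of norm `‖c‖`. With zero noise, Bessel's inequality turns an admissible output into an
estimate of `c` with squared error at most `‖c‖² / 72`
(`EigenSystem.norm_sq_sub_decode_le_of_recovers`).

Let `c` be standard Gaussian in real dimension `40 * r + 2`. For a fixed seed, each query reveals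
two real linear functionals of `c`, chosen from earlier answers. Once all answers are fixed, the
output is fixed and `c` still has at least `38 * r + 2` free Gaussian coordinates. Fubini, one
functional at a time, bounds the success probability by that of a ball in this dimension
(`SliceBounded.stdGaussian_le`), which a Chernoff bound makes small. Averaging over seeds
contradicts success probability `2/3` (`mul_stdGaussian_le`, `two_thirds_mul_gaussian_bound_lt`). -/

namespace FourierInterp

open ProbabilityTheory Module

/-! ### Adaptive slicing and Fubini for the Gaussian measure -/

section Gaussian

variable {E : Type} [NormedAddCommGroup E] [InnerProductSpace ℝ E]

/-- `S` can be cut into pieces of radius `ρ` by fixing `k` adaptively chosen linear functionals. -/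
def SliceBounded (ρ : ℝ) : ℕ → Set E → Prop
  | 0, S => ∃ a, S ⊆ Metric.closedBall a ρ
  | k + 1, S => ∃ f : E →ₗ[ℝ] ℝ, ∀ z, SliceBounded ρ k (S ∩ {x | f x = z})

theorem SliceBounded.mono {ρ : ℝ} {k : ℕ} {S S' : Set E} (h : SliceBounded ρ k S) (hS : S' ⊆ S) :
    SliceBounded ρ k S' := by
  induction k generalizing S S' with
  | zero =>
    obtain ⟨a, ha⟩ := h
    exact ⟨a, hS.trans ha⟩
  | succ k ih =>
    obtain ⟨f, hf⟩ := h
    exact ⟨f, fun z => ih (hf z) (Set.inter_subset_inter_left _ hS)⟩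

/-- Functionals restrict to the affine subspace by composing with `L`. At the bottom level, the
adjoint of `L` is a left inverse of norm at most one, so the radius does not grow. -/
theorem SliceBounded.preimage [FiniteDimensional ℝ E] {E' : Type} [NormedAddCommGroup E']
    [InnerProductSpace ℝ E'] [FiniteDimensional ℝ E'] {ρ : ℝ} {k : ℕ} {S : Set E}
    (h : SliceBounded ρ k S) (v : E) (L : E' →ₗᵢ[ℝ] E) :
    SliceBounded ρ k ((fun x => v + L x) ⁻¹' S) := by
  induction k generalizing S with
  | zero =>
    obtain ⟨a, ha⟩ := h
    let L' : E' →L[ℝ] E := L.toContinuousLinearMap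
    refine ⟨ContinuousLinearMap.adjoint L' (a - v), fun x hx => ?_⟩
    have h1 := ha hx
    rw [mem_closedBall_iff_norm] at h1 ⊢
    have h2 : ContinuousLinearMap.adjoint L' (L x) = x := by
      refine ext_inner_right ℝ fun w => ?_
      rw [ContinuousLinearMap.adjoint_inner_left]
      exact L.inner_map_map x w
    have h3 : x - ContinuousLinearMap.adjoint L' (a - v) =
        ContinuousLinearMap.adjoint L' (v + L x - a) := by
      simp only [map_sub, map_add, h2]
      abel
    rw [h3]
    refine (ContinuousLinearMap.le_opNorm _ _).trans (le_trans ?_ h1)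
    refine mul_le_of_le_one_left (norm_nonneg _) ?_
    rw [LinearIsometryEquiv.norm_map]
    exact L.norm_toContinuousLinearMap_le
  | succ k ih =>
    obtain ⟨f, hf⟩ := h
    refine ⟨f ∘ₗ L.toLinearMap, fun z => (ih (hf (f v + z))).mono ?_⟩
    rintro x ⟨hx, hz⟩
    refine ⟨hx, ?_⟩
    simpa using hz

/-- Riesz representation. The zero functional is covered by `c = 0` and an arbitrary `u`, so an
uninformative measurement also costs one dimension. -/
theorem exists_unit_smul_inner [FiniteDimensional ℝ E] [Nontrivial E] (f : E →ₗ[ℝ] ℝ) :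
    ∃ u : E, ‖u‖ = 1 ∧ ∃ c : ℝ, ∀ x, f x = c * inner ℝ u x := by
  set w := (InnerProductSpace.toDual ℝ E).symm (LinearMap.toContinuousLinearMap f) with hw
  have hf : ∀ x, f x = inner ℝ w x := fun x => by
    rw [hw, InnerProductSpace.toDual_symm_apply]
    rfl
  by_cases h0 : w = 0
  · obtain ⟨u, hu⟩ := exists_norm_eq E (zero_le_one)
    exact ⟨u, hu, 0, fun x => by rw [hf, h0, inner_zero_left, zero_mul]⟩
  · refine ⟨‖w‖⁻¹ • w, norm_smul_inv_norm h0, ‖w‖, fun x => ?_⟩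
    rw [hf, real_inner_smul_left, ← mul_assoc, mul_inv_cancel₀ (norm_ne_zero_iff.2 h0), one_mul]

variable [FiniteDimensional ℝ E] [MeasurableSpace E] [BorelSpace E]

/-- Fubini for the standard Gaussian measure, along the line spanned by a unit vector. -/
theorem exists_stdGaussian_apply_eq_lintegral {n : ℕ} (hn : finrank ℝ E = n + 1) {u : E}
    (hu : ‖u‖ = 1) : ∃ L : EuclideanSpace ℝ (Fin n) →ₗᵢ[ℝ] E, (∀ x, inner ℝ u (L x) = 0) ∧
      ∀ S : Set E, MeasurableSet S → stdGaussian E S =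
        ∫⁻ z, stdGaussian (EuclideanSpace ℝ (Fin n)) ((fun x => z • u + L x) ⁻¹' S)
          ∂gaussianReal 0 1 := by
  -- Complete `u` to an orthonormal basis with `b 0 = u`; the other vectors span the hyperplane
  -- parametrized by `L`.
  obtain ⟨b, hb⟩ := Orthonormal.exists_orthonormalBasis_extension_of_card_eq (𝕜 := ℝ) (E := E)
    (ι := Fin (n + 1)) (by simp [hn]) (v := fun _ => u) (s := {0})
    ⟨fun i => by simpa using hu, fun i j hij => (hij (Subsingleton.elim _ _)).elim⟩
  have hb0 : b 0 = u := hb 0 rfl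
  let g : Fin n → E := fun i => b i.succ
  have hg : Orthonormal ℝ g := b.orthonormal.comp _ (Fin.succ_injective n)
  let B := (EuclideanSpace.basisFun (Fin n) ℝ)
  let L0 : EuclideanSpace ℝ (Fin n) →ₗ[ℝ] E := B.toBasis.constr ℝ g
  have hL0 : L0 ∘ B.toBasis = g := by
    funext i
    simp [L0]
  let L : EuclideanSpace ℝ (Fin n) →ₗᵢ[ℝ] E := L0.isometryOfOrthonormal
    (v := B.toBasis) (by simp [B.orthonormal]) (by rw [hL0]; exact hg)
  have hL : ∀ x : Fin n → ℝ, L (WithLp.toLp 2 x) = ∑ i, x i • b i.succ := fun x => by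
    change L0 (WithLp.toLp 2 x) = _
    simp [L0, Basis.constr_apply_fintype, B, g]
  refine ⟨L, fun x => ?_, fun S hS => ?_⟩
  · rw [← WithLp.toLp_ofLp (p := 2) x, hL, inner_sum, ← hb0]
    refine Finset.sum_eq_zero fun i _ => ?_
    rw [inner_smul_right, b.orthonormal.2 (Fin.succ_ne_zero i).symm, mul_zero]
  · have hmeas : Measurable fun x : Fin (n + 1) → ℝ => ∑ i, x i • b i := by fun_prop
    have hmp := (measurePreserving_piFinSuccAbove (fun _ : Fin (n + 1) => gaussianReal 0 1) 0).symm
    rw [stdGaussian_eq_map_pi_orthonormalBasis b, Measure.map_apply hmeas hS,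
      ← hmp.measure_preimage (hmeas hS).nullMeasurableSet,
      Measure.prod_apply (hmp.measurable (hmeas hS))]
    refine lintegral_congr fun z => ?_
    rw [← map_pi_eq_stdGaussian, Measure.map_apply (by fun_prop)]
    · congr 1
      ext x
      simp [hL, Fin.sum_univ_succ, hb0]
    · exact (show Measurable fun x => z • u + L x from
        (L.continuous.const_add _).measurable) hS

end Gaussian

/-! ### Gaussian measure of balls and of adaptively sliced sets -/

section GaussianBounds

/-- Bounding the Gaussian density by its maximum leaves a translation-invariant integral, hence a
bound uniform in `a`. -/
theorem integral_exp_neg_mul_sub_sq_gaussianReal_le {t : ℝ} (ht : 0 < t) (a : ℝ) :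
    ∫ x, Real.exp (-t * (x - a) ^ 2) ∂gaussianReal 0 1 ≤ (√(2 * t))⁻¹ := by
  have hint : Integrable fun x : ℝ => Real.exp (-t * (x - a) ^ 2) :=
    (integrable_exp_neg_mul_sq ht).comp_sub_right a
  rw [integral_gaussianReal_eq_integral_smul one_ne_zero]
  calc ∫ x, gaussianPDFReal 0 1 x • Real.exp (-t * (x - a) ^ 2)
      ≤ ∫ x, (√(2 * Real.pi))⁻¹ * Real.exp (-t * (x - a) ^ 2) := by
        refine integral_mono_of_nonneg (Filter.Eventually.of_forall fun x => ?_)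
          (hint.const_mul _) (Filter.Eventually.of_forall fun x => ?_)
        · exact smul_nonneg (gaussianPDFReal_nonneg _ _ _) (Real.exp_pos _).le
        · simp only [smul_eq_mul]
          gcongr
          rw [gaussianPDFReal]
          simp only [NNReal.coe_one, mul_one]
          refine mul_le_of_le_one_right (by positivity) (Real.exp_le_one_iff.2 ?_)
          have := sq_nonneg (x - 0)
          linarith
    _ = (√(2 * t))⁻¹ := by
        rw [integral_const_mul, integral_sub_right_eq_self (fun x : ℝ => Real.exp (-t * x ^ 2)) a,
          integral_gaussian, ← Real.sqrt_inv, ← Real.sqrt_inv, ← Real.sqrt_mul (by positivity)]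
        congr 1
        field_simp

variable {E : Type} [NormedAddCommGroup E] [InnerProductSpace ℝ E] [FiniteDimensional ℝ E]
  [MeasurableSpace E] [BorelSpace E]

/-- Chernoff's method: Markov's inequality for `exp (-t * ‖x - a‖ ^ 2)`, whose integral factors over
coordinates. -/
theorem stdGaussian_real_closedBall_le {t : ℝ} (ht : 0 < t) (a : E) (ρ : ℝ) :
    (stdGaussian E).real (Metric.closedBall a ρ) ≤
      Real.exp (t * ρ ^ 2) * (√(2 * t))⁻¹ ^ finrank ℝ E := by
  let b := stdOrthonormalBasis ℝ E
  have hsub : ∀ x : Fin (finrank ℝ E) → ℝ,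
      Real.exp (-t * ‖∑ i, x i • b i - a‖ ^ 2) = ∏ i, Real.exp (-t * (x i - b.repr a i) ^ 2) := by
    intro x
    rw [← Real.exp_sum, ← Finset.mul_sum, ← b.sum_sq_norm_inner_right]
    congr 2
    refine Finset.sum_congr rfl fun i _ => ?_
    rw [inner_sub_right, b.orthonormal.inner_right_fintype, b.repr_apply_apply, Real.norm_eq_abs,
      sq_abs]
  have hmeas : Measurable fun x : Fin (finrank ℝ E) → ℝ => ∑ i, x i • b i := by fun_prop
  have hcont : Continuous fun x : E => Real.exp (-t * ‖x - a‖ ^ 2) := by fun_prop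
  have hI : ∫ x, Real.exp (-t * ‖x - a‖ ^ 2) ∂stdGaussian E ≤ (√(2 * t))⁻¹ ^ finrank ℝ E := by
    rw [stdGaussian_eq_map_pi_orthonormalBasis b,
      integral_map hmeas.aemeasurable hcont.aestronglyMeasurable]
    simp_rw [hsub]
    rw [integral_fintype_prod_eq_prod (fun i x => Real.exp (-t * (x - b.repr a i) ^ 2))]
    refine (Finset.prod_le_prod (fun i _ => integral_nonneg fun x => (Real.exp_pos _).le)
      fun i _ => integral_exp_neg_mul_sub_sq_gaussianReal_le ht _).trans ?_
    simp
  have hint : Integrable (fun x : E => Real.exp (-t * ‖x - a‖ ^ 2)) (stdGaussian E) := by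
    refine Integrable.of_bound hcont.aestronglyMeasurable 1 (Filter.Eventually.of_forall fun x => ?_)
    rw [Real.norm_eq_abs, Real.abs_exp, Real.exp_le_one_iff]
    have := sq_nonneg ‖x - a‖
    nlinarith
  have hM := mul_meas_ge_le_integral_of_nonneg
    (Filter.Eventually.of_forall fun x => (Real.exp_pos _).le) hint (Real.exp (-(t * ρ ^ 2)))
  have hS : (stdGaussian E).real (Metric.closedBall a ρ) ≤
      (stdGaussian E).real {x | Real.exp (-(t * ρ ^ 2)) ≤ Real.exp (-t * ‖x - a‖ ^ 2)} := by
    refine measureReal_mono fun x hx => ?_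
    rw [mem_closedBall_iff_norm] at hx
    have : ‖x - a‖ ^ 2 ≤ ρ ^ 2 := by gcongr
    simp only [Set.mem_ofPred_eq, Real.exp_le_exp]
    nlinarith
  calc _ ≤ _ := hS
    _ = Real.exp (t * ρ ^ 2) * (Real.exp (-(t * ρ ^ 2)) *
        (stdGaussian E).real {x | Real.exp (-(t * ρ ^ 2)) ≤ Real.exp (-t * ‖x - a‖ ^ 2)}) := by
      rw [← mul_assoc, ← Real.exp_add, add_neg_cancel, Real.exp_zero, one_mul]
    _ ≤ _ := by gcongr; exact hM.trans hI

theorem integral_norm_sq_stdGaussian : ∫ x, ‖x‖ ^ 2 ∂stdGaussian E = finrank ℝ E ∧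
    Integrable (fun x => ‖x‖ ^ 2) (stdGaussian E) := by
  let b := stdOrthonormalBasis ℝ E
  have hL : ∀ i, MemLp (innerSL ℝ (b i)) 2 (stdGaussian E) := fun i =>
    ContinuousLinearMap.comp_memLp' (innerSL ℝ (b i)) IsGaussian.memLp_two_id
  have h1 : ∀ i, ∫ x, (innerSL ℝ (b i) x) ^ 2 ∂stdGaussian E = 1 := fun i => by
    have h := variance_dual_stdGaussian (innerSL ℝ (b i))
    rw [variance_of_integral_eq_zero (hL i).aemeasurable
      (integral_strongDual_stdGaussian _)] at h
    rw [h, innerSL_apply_norm, b.norm_eq_one, one_pow]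
  have hs : (fun x : E => ‖x‖ ^ 2) = fun x => ∑ i, (innerSL ℝ (b i) x) ^ 2 := by
    funext x
    rw [← b.sum_sq_inner_right x]
    rfl
  rw [hs]
  refine ⟨?_, integrable_finsetSum _ fun i _ => (hL i).integrable_sq⟩
  rw [integral_finsetSum _ fun i _ => (hL i).integrable_sq]
  rw [Finset.sum_congr rfl fun i _ => h1 i]
  simp

theorem stdGaussian_real_norm_sq_ge_le {R : ℝ} (hR : 0 < R) :
    (stdGaussian E).real {x | R ≤ ‖x‖ ^ 2} ≤ finrank ℝ E / R := by
  have h := mul_meas_ge_le_integral_of_nonneg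
    (Filter.Eventually.of_forall fun x : E => sq_nonneg ‖x‖) integral_norm_sq_stdGaussian.2 R
  rw [integral_norm_sq_stdGaussian.1] at h
  rwa [le_div_iff₀' hR]

/-- A set that splits into pieces of radius `ρ` after `k` adaptive real linear measurements has the
Gaussian measure of a ball of radius `ρ` in codimension `k`, at most. -/
theorem SliceBounded.stdGaussian_le {t : ℝ} (ht : 0 < t) {ρ : ℝ} {k m : ℕ}
    (hE : finrank ℝ E = m + k) {S : Set E} (hS : MeasurableSet S) (h : SliceBounded ρ k S) :
    stdGaussian E S ≤ ENNReal.ofReal (Real.exp (t * ρ ^ 2) * (√(2 * t))⁻¹ ^ m) := by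
  induction k generalizing E with
  | zero =>
    obtain ⟨a, ha⟩ := h
    refine (measure_mono ha).trans ?_
    rw [← ofReal_measureReal]
    refine ENNReal.ofReal_le_ofReal ?_
    rw [← show finrank ℝ E = m from hE]
    exact stdGaussian_real_closedBall_le ht a ρ
  | succ k ih =>
    have hE' : finrank ℝ E = m + k + 1 := hE
    have : Nontrivial E := Module.nontrivial_of_finrank_pos (R := ℝ) (by omega)
    obtain ⟨f, hf⟩ := h
    obtain ⟨u, hu, c, hc⟩ := exists_unit_smul_inner f
    obtain ⟨L, hL, hLS⟩ := exists_stdGaussian_apply_eq_lintegral hE' hu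
    rw [hLS S hS]
    calc _ ≤ ∫⁻ _, ENNReal.ofReal (Real.exp (t * ρ ^ 2) * (√(2 * t))⁻¹ ^ m)
          ∂gaussianReal 0 1 := by
          refine lintegral_mono fun z => ih (by simp) ?_ ?_
          · exact (show Measurable fun x => z • u + L x from
              (L.continuous.const_add _).measurable) hS
          -- Since `f = c * ⟪u, ·⟫` and `L` maps into the orthogonal complement of `u`, the fibre
          -- over `z` lies in the level set `f = c * z`.
          · refine ((hf (c * z)).preimage (z • u) L).mono fun x hx => ⟨hx, ?_⟩
            simp only [Set.mem_ofPred_eq, hc, inner_add_right, inner_smul_right, hL,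
              real_inner_self_eq_norm_sq, hu]
            ring
      _ = _ := by simp

end GaussianBounds

/-! ### Success probability of an algorithm on Gaussian parameters -/

namespace QueryAlgorithm

variable {Ω : Type*} [MeasurableSpace Ω] {T : ℝ} (A : QueryAlgorithm Ω T)

theorem answers_eq_of_le {f g : ℝ → ℂ} {ω : Ω} {j k : ℕ} (hjk : j ≤ k)
    (h : A.answers f ω k = A.answers g ω k) : A.answers f ω j = A.answers g ω j := by
  induction k, hjk using Nat.le_induction with
  | base => exact h
  | succ k _ ih =>
    refine ih ?_
    have := congrArg Fin.init h
    simpa only [answers, Fin.init_snoc] using this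

/-- Answers are formally defined after halting too, so two runs can be compared at a common length
`r`. Equal answers have equal prefixes, which determine the halting time. -/
theorem StopsAfter.eq {f g : ℝ → ℂ} {ω : Ω} {r k l : ℕ} (hk : A.StopsAfter f ω k)
    (hl : A.StopsAfter g ω l) (hkr : k ≤ r) (hlr : l ≤ r)
    (h : A.answers f ω r = A.answers g ω r) : k = l := by
  rcases lt_trichotomy k l with hkl | hkl | hkl
  · have := hl.2 k hkl
    rw [← A.answers_eq_of_le hkr h] at this
    exact (this hk.1).elim
  · exact hkl
  · have := hk.2 l hkl
    rw [A.answers_eq_of_le hlr h] at this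
    exact (this hl.1).elim

variable {E : Type} [NormedAddCommGroup E] [InnerProductSpace ℝ E] (φ : E →ₗ[ℝ] ℝ → ℂ)
  (a : L2T T → E) (ρ : ℝ) (r : ℕ)

/-- The pairs of a seed and a parameter for which the output after at most `r` queries, decoded
by `a`, is within `ρ` of the parameter. -/
def successSet : Set (Ω × E) :=
  {p | ∃ k ≤ r, A.StopsAfter (φ p.2) p.1 k ∧
    dist p.2 (a (A.output k (p.1, A.answers (φ p.2) p.1 k))) ≤ ρ}

/-- The seed and the answers `v` fix the next query point, and the value there is linear in the
parameter; fixing its real and imaginary parts spends two functionals. When no query remains, all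
successful parameters share one output, so they lie in one ball around its decoding. -/
theorem sliceBounded_successSet_inter (ω : Ω) (s j : ℕ) (hj : j + s = r) (v : Fin j → ℂ) :
    SliceBounded ρ (2 * s)
      ({c | (ω, c) ∈ A.successSet φ a ρ r} ∩ {c | A.answers (φ c) ω j = v}) := by
  induction s generalizing j with
  | zero =>
    obtain rfl : j = r := hj
    rcases Set.eq_empty_or_nonempty
      ({c | (ω, c) ∈ A.successSet φ a ρ j} ∩ {c | A.answers (φ c) ω j = v}) with h | ⟨c, hc, hcv⟩
    · exact ⟨0, by rw [h]; exact Set.empty_subset _⟩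
    · obtain ⟨k, hk, hs, -⟩ := hc
      refine ⟨a (A.output k (ω, A.answers (φ c) ω k)), ?_⟩
      rintro d ⟨⟨l, hl, hs', hd⟩, hdv⟩
      have hcd : A.answers (φ c) ω j = A.answers (φ d) ω j := Eq.trans hcv (Eq.symm hdv)
      obtain rfl : k = l := StopsAfter.eq A hs hs' hk hl hcd
      rw [A.answers_eq_of_le hk hcd]
      exact hd
  | succ s ih =>
    let f : E →ₗ[ℝ] ℂ := LinearMap.proj ((A.query j (ω, v) : Set.Icc (0 : ℝ) T) : ℝ) ∘ₗ φ
    refine ⟨Complex.reLm ∘ₗ f, fun x => ⟨Complex.imLm ∘ₗ f, fun y => ?_⟩⟩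
    refine (ih (j + 1) (by omega) (Fin.snoc v ⟨x, y⟩)).mono ?_
    rintro c ⟨⟨⟨hc, hv⟩, hx⟩, hy⟩
    refine ⟨hc, ?_⟩
    have hv' : A.answers (φ c) ω j = v := hv
    have hz : φ c (A.query j (ω, v)) = ⟨x, y⟩ := Complex.ext hx hy
    rw [Set.mem_ofPred_eq, answers, hv', hz]

theorem sliceBounded_successSet (ω : Ω) :
    SliceBounded ρ (2 * r) {c | (ω, c) ∈ A.successSet φ a ρ r} :=
  (A.sliceBounded_successSet_inter φ a ρ r ω r 0 (zero_add r) Fin.elim0).mono fun _ hc =>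
    ⟨hc, Subsingleton.elim _ _⟩

variable [MeasurableSpace E]

theorem measurable_answers (hφ : Measurable fun p : E × ℝ => φ p.1 p.2) (k : ℕ) :
    Measurable fun p : Ω × E => A.answers (φ p.2) p.1 k := by
  induction k with
  | zero => exact measurable_of_subsingleton_codomain _
  | succ k ih =>
    refine measurable_pi_iff.2 fun i => ?_
    have hq : Measurable fun p : Ω × E => A.query k (p.1, A.answers (φ p.2) p.1 k) :=
      (A.measurable_query k).comp (measurable_fst.prodMk ih)
    refine Fin.lastCases ?_ (fun i => ?_) i
    · simp only [answers, Fin.snoc_last]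
      exact hφ.comp (measurable_snd.prodMk hq.subtype_val)
    · simp only [answers, Fin.snoc_castSucc]
      exact measurable_pi_iff.1 ih i

theorem measurableSet_stopsAfter (hφ : Measurable fun p : E × ℝ => φ p.1 p.2) (k : ℕ) :
    MeasurableSet {p : Ω × E | A.StopsAfter (φ p.2) p.1 k} := by
  have h : ∀ j, MeasurableSet {p : Ω × E | (p.1, A.answers (φ p.2) p.1 j) ∈ A.halts j} :=
    fun j => (measurable_fst.prodMk (A.measurable_answers φ hφ j)) (A.measurableSet_halts j)
  have h' : {p : Ω × E | A.StopsAfter (φ p.2) p.1 k} =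
      {p : Ω × E | (p.1, A.answers (φ p.2) p.1 k) ∈ A.halts k} ∩
        ⋂ j, ⋂ _ : j < k, {p : Ω × E | (p.1, A.answers (φ p.2) p.1 j) ∈ A.halts j}ᶜ := by
    ext p
    simp [StopsAfter]
  rw [h']
  exact (h k).inter (MeasurableSet.iInter fun j => MeasurableSet.iInter fun _ => (h j).compl)

variable [FiniteDimensional ℝ E] [BorelSpace E]

theorem measurableSet_successSet (hφ : Measurable fun p : E × ℝ => φ p.1 p.2)
    (ha : Continuous a) : MeasurableSet (A.successSet φ a ρ r) := by
  have h : A.successSet φ a ρ r = ⋃ k, ⋃ _ : k ≤ r, {p : Ω × E | A.StopsAfter (φ p.2) p.1 k} ∩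
      {p : Ω × E | dist p.2 (a (A.output k (p.1, A.answers (φ p.2) p.1 k))) ≤ ρ} := by
    ext p
    simp [successSet, and_left_comm]
  rw [h]
  refine MeasurableSet.iUnion fun k => MeasurableSet.iUnion fun _ =>
    (A.measurableSet_stopsAfter φ hφ k).inter (measurableSet_le ?_ measurable_const)
  have : SecondCountableTopology E := 
    have := FiniteDimensional.proper ℝ E
    inferInstance
  refine measurable_snd.dist ?_
  borelize (L2T T)
  exact ha.measurable.comp ((A.measurable_output k).comp
    (measurable_fst.prodMk (A.measurable_answers φ hφ k)))

/-- If, for every parameter of norm at most `R`, an algorithm with `r` queries recovers the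
parameter up to `ρ` with probability at least `p`, then `p` is bounded by Gaussian quantities. -/
theorem mul_stdGaussian_le (hφ : Measurable fun p : E × ℝ => φ p.1 p.2) (ha : Continuous a)
    {P : Measure Ω} [IsProbabilityMeasure P] {t : ℝ} (ht : 0 < t) {m : ℕ}
    (hE : finrank ℝ E = m + 2 * r) {R : ℝ} (hR : 0 < R) {p : ℝ≥0∞}
    (h : ∀ c : E, ‖c‖ ^ 2 < R → p ≤ P {ω | (ω, c) ∈ A.successSet φ a ρ r}) :
    p * ENNReal.ofReal (1 - finrank ℝ E / R) ≤
      ENNReal.ofReal (Real.exp (t * ρ ^ 2) * (√(2 * t))⁻¹ ^ m) := by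
  have hG := A.measurableSet_successSet φ a ρ r hφ ha
  have hB : MeasurableSet {c : E | ‖c‖ ^ 2 < R} :=
    measurableSet_lt (by fun_prop) measurable_const
  have hBge : ENNReal.ofReal (1 - finrank ℝ E / R) ≤ stdGaussian E {c : E | ‖c‖ ^ 2 < R} := by
    rw [← ofReal_measureReal]
    refine ENNReal.ofReal_le_ofReal ?_
    have h1 := stdGaussian_real_norm_sq_ge_le (E := E) hR
    have h2 := probReal_compl_eq_one_sub (μ := stdGaussian E) hB
    have h3 : {c : E | ‖c‖ ^ 2 < R}ᶜ = {c : E | R ≤ ‖c‖ ^ 2} := by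
      ext c
      simp
    rw [h3] at h2
    linarith
  calc p * ENNReal.ofReal (1 - finrank ℝ E / R)
      ≤ p * stdGaussian E {c : E | ‖c‖ ^ 2 < R} := by gcongr
    _ = ∫⁻ _ in {c : E | ‖c‖ ^ 2 < R}, p ∂stdGaussian E := (setLIntegral_const _ _).symm
    _ ≤ ∫⁻ c in {c : E | ‖c‖ ^ 2 < R}, P {ω | (ω, c) ∈ A.successSet φ a ρ r} ∂stdGaussian E :=
        setLIntegral_mono' hB h
    _ ≤ ∫⁻ c, P {ω | (ω, c) ∈ A.successSet φ a ρ r} ∂stdGaussian E := setLIntegral_le_lintegral _ _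
    -- Exchange the average over parameters with the average over seeds: each fixed seed leaves a
    -- deterministic algorithm.
    _ = P.prod (stdGaussian E) (A.successSet φ a ρ r) := (Measure.prod_apply_symm hG).symm
    _ = ∫⁻ ω, stdGaussian E {c | (ω, c) ∈ A.successSet φ a ρ r} ∂P := Measure.prod_apply hG
    _ ≤ ∫⁻ _, ENNReal.ofReal (Real.exp (t * ρ ^ 2) * (√(2 * t))⁻¹ ^ m) ∂P :=
        lintegral_mono fun ω => (A.sliceBounded_successSet φ a ρ r ω).stdGaussian_le ht hE
          (measurable_prodMk_left hG)
    _ = _ := by simp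

end QueryAlgorithm

/-! ### Adjointness of the Fourier operators -/

theorem coeFn_charOperator (σ : ℝ) (α β : Measure ℝ) [IsFiniteMeasure α] [IsFiniteMeasure β]
    (f : Lp ℂ 2 α) : charOperator σ α β f =ᵐ[β] charTransform σ α f :=
  MemLp.coeFn_toLp (memLp_charTransform σ β (integrable_Lp f))

/-- Fubini; conjugating the exponential changes the sign of `σ`. -/
theorem inner_charOperator_left (σ : ℝ) (α β : Measure ℝ) [IsFiniteMeasure α] [IsFiniteMeasure β]
    (f : Lp ℂ 2 α) (g : Lp ℂ 2 β) :
    inner ℂ (charOperator σ α β f) g = inner ℂ f (charOperator (-σ) β α g) := by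
  rw [L2.inner_def, L2.inner_def]
  have hl : ∫ w, inner ℂ (charOperator σ α β f w) (g w) ∂β = ∫ w, ∫ v,
      g w * (starRingEnd ℂ) (f v) * Complex.exp ((-σ * w * v : ℝ) * Complex.I) ∂α ∂β := by
    refine integral_congr_ae ?_
    filter_upwards [coeFn_charOperator σ α β f] with w hw
    rw [hw, RCLike.inner_apply, charTransform, ← integral_conj, ← integral_const_mul]
    refine integral_congr_ae (Filter.Eventually.of_forall fun v => ?_)
    simp only [map_mul, ← Complex.exp_conj, Complex.conj_ofReal, Complex.conj_I, mul_assoc]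
    congr 3
    push_cast
    ring
  have hr : ∫ v, inner ℂ (f v) (charOperator (-σ) β α g v) ∂α = ∫ v, ∫ w,
      g w * (starRingEnd ℂ) (f v) * Complex.exp ((-σ * w * v : ℝ) * Complex.I) ∂β ∂α := by
    refine integral_congr_ae ?_
    filter_upwards [coeFn_charOperator (-σ) β α g] with v hv
    rw [hv, RCLike.inner_apply, charTransform, ← integral_mul_const]
    refine integral_congr_ae (Filter.Eventually.of_forall fun w => ?_)
    simp only
    ring
  rw [hl, hr]
  refine integral_integral_swap ?_
  have hc : Integrable (fun v => (starRingEnd ℂ) (f v)) α :=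
    (integrable_Lp f).congr'
      (Complex.continuous_conj.comp_aestronglyMeasurable (integrable_Lp f).aestronglyMeasurable)
      (Filter.Eventually.of_forall fun v => (RCLike.norm_conj _).symm)
  refine ((integrable_Lp g).mul_prod hc).mul_bdd (c := 1)
    (Continuous.aestronglyMeasurable (by fun_prop)) (Filter.Eventually.of_forall fun p => ?_)
  rw [Complex.norm_exp_ofReal_mul_I]

theorem energy_coeFn {α : Measure ℝ} (f : Lp ℂ 2 α) : energy α f = ENNReal.ofReal (‖f‖ ^ 2) := by
  rw [ENNReal.ofReal_pow (norm_nonneg f), ofReal_norm, Lp.enorm_def]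
  have h := eLpNorm_nnreal_pow_eq_lintegral (f := (f : ℝ → ℂ)) (μ := α) (p := 2) (by norm_num)
  rw [energy]
  norm_num at h
  exact h.symm

section Operators

variable (μ : Measure ℝ) [IsFiniteMeasure μ] (T : ℝ)

theorem inner_invFourierOp_left (x : Lp ℂ 2 μ) (z : L2T T) :
    inner ℂ (invFourierOp μ T x) z = inner ℂ x (fourierOp μ T z) :=
  inner_charOperator_left _ _ _ x z

theorem inner_fourierOp_left (x : Lp ℂ 2 μ) (z : L2T T) :
    inner ℂ (fourierOp μ T z) x = inner ℂ z (invFourierOp μ T x) := by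
  rw [← inner_conj_symm, ← inner_invFourierOp_left, inner_conj_symm]

theorem inner_fourierOp_fourierOp (z w : L2T T) :
    inner ℂ (fourierOp μ T z) (fourierOp μ T w) = inner ℂ (kernelOp μ T z) w :=
  (inner_invFourierOp_left μ T _ w).symm

theorem isSymmetric_kernelOp : (kernelOp μ T : L2T T →ₗ[ℂ] L2T T).IsSymmetric := fun z w =>
  (inner_invFourierOp_left μ T _ w).trans (inner_fourierOp_left μ T _ z)

theorem recovers_zero_iff {ε C : ℝ} (hε : 0 ≤ ε) (x : Lp ℂ 2 μ) (y : L2T T) :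
    Recovers μ T ε C x 0 y ↔ ‖invFourierOp μ T x - y‖ ^ 2 ≤ ε * ‖x‖ ^ 2 := by
  have h1 : energy (uniformOn T) (fun t => invFourier μ x t - y t) =
      energy (uniformOn T) (invFourierOp μ T x - y : L2T T) := by
    refine lintegral_congr_ae ?_
    filter_upwards [Lp.coeFn_sub (invFourierOp μ T x) y,
      coeFn_charOperator (2 * Real.pi) μ (uniformOn T) x] with t h h'
    rw [h, Pi.sub_apply, invFourierOp, h']
    rfl
  have h2 : energy (uniformOn T) (0 : ℝ → ℂ) = 0 := by simp [energy]
  rw [Recovers, h1, h2, mul_zero, add_zero, energy_coeFn, energy_coeFn, ← ENNReal.ofReal_mul hε,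
    ENNReal.ofReal_le_ofReal_iff (by positivity)]

/-- Pointwise evaluation of the inverse Fourier transform, as a linear functional. -/
def invFourierEval (t : ℝ) : Lp ℂ 2 μ →ₗ[ℂ] ℂ where
  toFun x := invFourier μ x t
  map_add' x y := by
    rw [invFourier, charTransform_congr _ (Lp.coeFn_add x y)]
    simp only [invFourier, charTransform, Pi.add_apply, add_mul]
    exact integral_add (integrable_charTransform _ (integrable_Lp x) t)
      (integrable_charTransform _ (integrable_Lp y) t)
  map_smul' c x := by
    rw [invFourier, charTransform_congr _ (Lp.coeFn_smul c x)]
    simp only [invFourier, charTransform, Pi.smul_apply, smul_eq_mul, mul_assoc, RingHom.id_apply]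
    exact integral_const_mul _ _

end Operators

/-! ### Orthonormal eigenvectors from the eigenvalue count -/

theorem exists_orthonormal_of_le_rank {V : Type*} [NormedAddCommGroup V] [InnerProductSpace ℂ V]
    {k : ℕ} (hk : (k : Cardinal) ≤ Module.rank ℂ V) : ∃ v : Fin k → V, Orthonormal ℂ v := by
  obtain ⟨v, hv⟩ := exists_linearIndependent_of_le_rank hk
  exact ⟨_, InnerProductSpace.gramSchmidtNormed_orthonormal hv⟩

/-- Replaces multiplicities by finite ones. An infinite multiplicity alone supplies `M + 1`, so
compactness of the operator is not needed. -/
theorem exists_natCast_le_of_lt_sum {ι : Type*} {s : Finset ι} {d : ι → ℕ∞} {M : ℕ}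
    (h : (M : ℝ≥0∞) < ∑ l ∈ s, (d l : ℝ≥0∞)) :
    ∃ k : ι → ℕ, (∀ l, (k l : ℕ∞) ≤ d l) ∧ M < ∑ l ∈ s, k l := by
  classical
  by_cases ht : ∃ l ∈ s, d l = ⊤
  · obtain ⟨l₀, hl₀, hd⟩ := ht
    refine ⟨Pi.single l₀ (M + 1), fun l => ?_, ?_⟩
    · by_cases hl : l = l₀
      · rw [hl, hd]
        exact le_top
      · simp [hl]
    · rw [Finset.sum_pi_single', if_pos hl₀]
      exact Nat.lt_succ_self M
  · push Not at ht
    refine ⟨fun l => (d l).toNat, fun l => ENat.natCast_toNat_le_self _, ?_⟩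
    have hsum : ∑ l ∈ s, (d l : ℝ≥0∞) = ((∑ l ∈ s, (d l).toNat : ℕ) : ℝ≥0∞) := by
      rw [Nat.cast_sum]
      refine Finset.sum_congr rfl fun l hl => ?_
      rw [← ENat.toENNReal_coe, ENat.natCast_toNat (ht l hl)]
    rw [hsum] at h
    exact_mod_cast h

/-- Some finite partial sum already exceeds `M`; orthonormal systems in those eigenspaces combine,
as eigenspaces of a symmetric operator are orthogonal. -/
theorem exists_orthonormal_eigenvectors {H : Type*} [NormedAddCommGroup H] [InnerProductSpace ℂ H]
    {K : H →ₗ[ℂ] H} (hK : K.IsSymmetric) {δ : ℝ} {M : ℕ}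
    (h : (M : ℝ≥0∞) < ∑' l : Set.Ici δ, ((Cardinal.toENat (Module.rank ℂ
      (Module.End.eigenspace K ((l : ℝ) : ℂ))) : ℕ∞) : ℝ≥0∞)) :
    ∃ (e : Fin (M + 1) → H) (l : Fin (M + 1) → ℝ), Orthonormal ℂ e ∧
      ∀ i, δ ≤ l i ∧ K (e i) = (l i : ℂ) • e i := by
  rw [ENNReal.tsum_eq_iSup_sum] at h
  obtain ⟨s, hs⟩ := lt_iSup_iff.1 h
  have hd : ∃ k : Set.Ici δ → ℕ, (∀ l, (k l : ℕ∞) ≤ Cardinal.toENat (Module.rank ℂ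
      (Module.End.eigenspace K ((l : ℝ) : ℂ)))) ∧ M < ∑ l ∈ s, k l :=
    exists_natCast_le_of_lt_sum hs
  obtain ⟨k, hk, hsum⟩ := hd
  choose v hv using fun l => exists_orthonormal_of_le_rank (Cardinal.natCast_le_toENat.1 (hk l))
  have hfam : OrthogonalFamily ℂ (fun l : s => Module.End.eigenspace K (((l : Set.Ici δ) : ℝ) : ℂ))
      fun l => (Module.End.eigenspace K (((l : Set.Ici δ) : ℝ) : ℂ)).subtypeₗᵢ :=
    hK.orthogonalFamily_eigenspaces.comp (γ := s)
      (f := fun l => (((l : Set.Ici δ) : ℝ) : ℂ)) fun l l' hl =>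
        Subtype.ext (Subtype.ext (Complex.ofReal_injective hl))
  have ho := hfam.orthonormal_sigma_orthonormal (α := fun l : s => Fin (k l))
    (v_family := fun l => v l) fun l => hv l
  have hcard : Fintype.card (Fin (M + 1)) ≤ Fintype.card ((l : s) × Fin (k l)) := by
    rw [Fintype.card_sigma, Fintype.card_fin]
    simp only [Fintype.card_fin]
    rw [Finset.sum_coe_sort s k]
    exact hsum
  obtain ⟨j⟩ := Function.Embedding.nonempty_of_card_le hcard
  refine ⟨_, fun i => ((j i).1 : Set.Ici δ), ho.comp j j.injective, fun i => ⟨(j i).1.1.2, ?_⟩⟩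
  exact Module.End.mem_eigenspace_iff.1 (v (j i).1 (j i).2).2

/-- By `e < 3`, the left side is at most `3 ^ (20 * r + 1) / 12 ^ (19 * r + 1) ≤ 1 / 4`, because `3
^ 20 ≤ 12 ^ 19`; the right side is `2/3 * 5/6 = 5/9`. -/
theorem two_thirds_mul_gaussian_bound_lt (r : ℕ) :
    ENNReal.ofReal (Real.exp (6 * √((20 * r + 1 : ℝ) / 6) ^ 2) *
      (√(2 * 6))⁻¹ ^ (38 * r + 2)) <
    2 / 3 * ENNReal.ofReal (1 - (40 * r + 2 : ℝ) / (12 * (20 * r + 1))) := by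
  have h1 : (1 : ℝ) - (40 * r + 2 : ℝ) / (12 * (20 * r + 1)) = 5 / 6 := by
    field_simp
    ring
  have h2 : (2 / 3 : ℝ≥0∞) = ENNReal.ofReal (2 / 3) := by
    rw [ENNReal.ofReal_div_of_pos (by norm_num)]
    norm_num
  rw [h1, h2, ← ENNReal.ofReal_mul (by norm_num), ENNReal.ofReal_lt_ofReal_iff (by norm_num)]
  have h3 : Real.exp (6 * √((20 * r + 1 : ℝ) / 6) ^ 2) ≤ 3 ^ (20 * r + 1) := by
    rw [Real.sq_sqrt (by positivity), show 6 * ((20 * r + 1 : ℝ) / 6) = (20 * r + 1 : ℕ) * 1 by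
      push_cast; ring, Real.exp_nat_mul]
    gcongr
    exact Real.exp_one_lt_three.le
  have h4 : (√(2 * 6 : ℝ))⁻¹ ^ (38 * r + 2) = (1 / 12) ^ (19 * r + 1) := by
    rw [show 38 * r + 2 = 2 * (19 * r + 1) by ring, pow_mul, inv_pow, Real.sq_sqrt (by norm_num)]
    norm_num
  rw [h4]
  calc _ ≤ (3 : ℝ) ^ (20 * r + 1) * (1 / 12) ^ (19 * r + 1) := by gcongr
    _ = ((3 : ℝ) ^ 20 * (1 / 12) ^ 19) ^ r * (1 / 4) := by
      rw [pow_succ, pow_succ, pow_mul, pow_mul, mul_pow]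
      ring
    _ ≤ 1 * (1 / 4) := by
      gcongr
      exact pow_le_one₀ (by norm_num) (by norm_num)
    _ < _ := by norm_num

/-! ### Encoding parameters as inputs and decoding outputs -/

/-- An orthonormal system of `L₂(T)` of eigenvectors of the kernel operator, with eigenvalues at
least `72 ε`, and its normalized images in `L₂(μ)`. -/
structure EigenSystem (μ : Measure ℝ) [IsFiniteMeasure μ] (T ε : ℝ) (N : ℕ) where
  vec : Fin N → L2T T
  val : Fin N → ℝ
  orthonormal : Orthonormal ℂ vec
  le_val : ∀ i, 72 * ε ≤ val i
  kernelOp_vec : ∀ i, kernelOp μ T (vec i) = (val i : ℂ) • vec i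

namespace EigenSystem

variable {μ : Measure ℝ} [IsFiniteMeasure μ] {T ε : ℝ} {N : ℕ} (B : EigenSystem μ T ε N)

/-- The normalized images of the eigenvectors in `L₂(μ)`. -/
def freq (i : Fin N) : Lp ℂ 2 μ := ((√(B.val i) : ℝ) : ℂ)⁻¹ • fourierOp μ T (B.vec i)

/-- The input with given coordinates. -/
def input (c : EuclideanSpace ℂ (Fin N)) : Lp ℂ 2 μ := ∑ i, c i • B.freq i

/-- The signal with given coordinates, as a function on the line. -/
def signal : EuclideanSpace ℂ (Fin N) →ₗ[ℝ] ℝ → ℂ where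
  toFun c t := ∑ i, c i * invFourier μ (B.freq i) t
  map_add' c d := by
    funext t
    simp [add_mul, Finset.sum_add_distrib]
  map_smul' s c := by
    funext t
    simp [Finset.mul_sum, mul_assoc]

/-- The coordinates recovered from an output. -/
def decode (y : L2T T) : EuclideanSpace ℂ (Fin N) :=
  WithLp.toLp 2 fun i => ((√(B.val i) : ℝ) : ℂ)⁻¹ * inner ℂ (B.vec i) y

theorem invFourier_input (c : EuclideanSpace ℂ (Fin N)) :
    invFourier μ (B.input c) = B.signal c := by
  funext t
  change invFourierEval μ t (B.input c) = _
  simp only [input, map_sum, map_smul, smul_eq_mul]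
  rfl

theorem measurable_signal :
    Measurable fun p : EuclideanSpace ℂ (Fin N) × ℝ => B.signal p.1 p.2 := by
  have h : ∀ i, Continuous (invFourier μ (B.freq i)) := fun i =>
    continuous_charTransform _ (integrable_Lp _)
  refine Continuous.measurable ?_
  change Continuous fun p : EuclideanSpace ℂ (Fin N) × ℝ =>
    ∑ i, p.1 i * invFourier μ (B.freq i) p.2
  exact continuous_finsetSum _ fun i _ =>
    (by fun_prop : Continuous fun p : EuclideanSpace ℂ (Fin N) × ℝ => p.1 i).mul
      ((h i).comp continuous_snd)

theorem continuous_decode : Continuous B.decode := by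
  unfold decode
  fun_prop

theorem val_pos (hε : 0 < ε) (i : Fin N) : 0 < B.val i := by
  have := B.le_val i
  linarith

theorem sqrt_val_ne_zero (hε : 0 < ε) (i : Fin N) : ((√(B.val i) : ℝ) : ℂ) ≠ 0 :=
  Complex.ofReal_ne_zero.2 (Real.sqrt_pos.2 (B.val_pos hε i)).ne'

theorem sqrt_val_mul_self (hε : 0 < ε) (i : Fin N) :
    ((√(B.val i) : ℝ) : ℂ) * ((√(B.val i) : ℝ) : ℂ) = (B.val i : ℂ) := by
  rw [← Complex.ofReal_mul, Real.mul_self_sqrt (B.val_pos hε i).le]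

/-- The Gram matrix of the unnormalized images is that of the kernel operator, which is diagonal on
eigenvectors. -/
theorem orthonormal_freq (hε : 0 < ε) : Orthonormal ℂ B.freq := by
  rw [orthonormal_iff_ite]
  intro i j
  rw [freq, freq, inner_smul_left, inner_smul_right, inner_fourierOp_fourierOp, B.kernelOp_vec,
    inner_smul_left, orthonormal_iff_ite.1 B.orthonormal i j]
  split_ifs with h
  · subst h
    have := B.sqrt_val_ne_zero hε i
    rw [map_inv₀, Complex.conj_ofReal, Complex.conj_ofReal, ← B.sqrt_val_mul_self hε i]
    field_simp
  · simp

theorem norm_sq_input (hε : 0 < ε) (c : EuclideanSpace ℂ (Fin N)) : ‖B.input c‖ ^ 2 = ‖c‖ ^ 2 := by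
  have h := (B.orthonormal_freq hε).inner_sum c c Finset.univ
  rw [← Complex.ofReal_inj, EuclideanSpace.norm_sq_eq]
  push_cast
  refine (inner_self_eq_norm_sq_to_K (𝕜 := ℂ) (B.input c)).symm.trans ?_
  rw [input, h]
  refine Finset.sum_congr rfl fun i _ => ?_
  exact RCLike.conj_mul _

theorem inner_vec_invFourierOp_input (hε : 0 < ε) (c : EuclideanSpace ℂ (Fin N)) (i : Fin N) :
    inner ℂ (B.vec i) (invFourierOp μ T (B.input c)) = ((√(B.val i) : ℝ) : ℂ) * c i := by
  have h : fourierOp μ T (B.vec i) = ((√(B.val i) : ℝ) : ℂ) • B.freq i := by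
    rw [freq, smul_smul, mul_inv_cancel₀ (B.sqrt_val_ne_zero hε i), one_smul]
  rw [← inner_fourierOp_left, h, inner_smul_left, Complex.conj_ofReal, input,
    (B.orthonormal_freq hε).inner_right_fintype]

/-- Bessel's inequality: the coefficient of the error along `B.vec i` is `√(B.val i)` times the
decoding error in coordinate `i`. -/
theorem norm_sq_sub_decode_le (hε : 0 < ε) (c : EuclideanSpace ℂ (Fin N)) (y : L2T T) :
    72 * ε * ‖c - B.decode y‖ ^ 2 ≤ ‖invFourierOp μ T (B.input c) - y‖ ^ 2 := by
  refine le_trans ?_ (B.orthonormal.sum_inner_products_le _ (s := Finset.univ))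
  rw [EuclideanSpace.norm_sq_eq, Finset.mul_sum]
  refine Finset.sum_le_sum fun i _ => ?_
  have h : inner ℂ (B.vec i) (invFourierOp μ T (B.input c) - y) =
      ((√(B.val i) : ℝ) : ℂ) * (c - B.decode y) i := by
    rw [inner_sub_right, B.inner_vec_invFourierOp_input hε, PiLp.sub_apply, mul_sub]
    congr 1
    exact (mul_inv_cancel_left₀ (B.sqrt_val_ne_zero hε i) _).symm
  rw [h, norm_mul, mul_pow, Complex.norm_real, Real.norm_eq_abs, sq_abs,
    Real.sq_sqrt (B.val_pos hε i).le]
  gcongr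
  exact B.le_val i

theorem norm_sq_sub_decode_le_of_recovers (hε : 0 < ε) {C : ℝ} {c : EuclideanSpace ℂ (Fin N)}
    {y : L2T T}
    (h : Recovers μ T ε C (B.input c) 0 y) : ‖c - B.decode y‖ ^ 2 ≤ ‖c‖ ^ 2 / 72 := by
  rw [recovers_zero_iff μ T hε.le, B.norm_sq_input hε] at h
  have h' := (B.norm_sq_sub_decode_le hε c y).trans h
  rw [mul_comm 72 ε, mul_assoc] at h'
  rw [le_div_iff₀' (by norm_num)]
  exact le_of_mul_le_mul_left h' hε

end EigenSystem

end FourierInterp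
end

/-! ### The lower bound -/

theorem mainTheorem10 (μ : Measure ℝ) [IsProbabilityMeasure μ] (T ε C : ℝ)
    (hT : 0 < T) (hε : 0 < ε) (hC : 1 ≤ C)
    (𝒩 : Set (ℝ → ℂ)) (h𝒩 : (0 : ℝ → ℂ) ∈ 𝒩)
    {Ω : Type*} [MeasurableSpace Ω] (P : Measure Ω) [IsProbabilityMeasure P]
    (A : FourierInterp.QueryAlgorithm Ω T) (r : ℕ)
    (hquery : A.MakesAtMost μ 𝒩 r)
    (hsolve : A.SolvesWithProb P μ ε C 𝒩 (2 / 3)) :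
    FourierInterp.eigenvalueCount μ T (72 * ε) / 20 ≤ (r : ℝ≥0∞) := by
  refine ENNReal.div_le_of_le_mul (le_of_not_gt fun h => ?_)
  obtain ⟨e, l, he, hl⟩ := FourierInterp.exists_orthonormal_eigenvectors (M := 20 * r)
    (FourierInterp.isSymmetric_kernelOp μ T) (δ := 72 * ε) (by
      rw [mul_comm] at h
      exact_mod_cast h)
  let B : FourierInterp.EigenSystem μ T ε (20 * r + 1) :=
    ⟨e, l, he, fun i => (hl i).1, fun i => (hl i).2⟩
  have hdim : Module.finrank ℝ (EuclideanSpace ℂ (Fin (20 * r + 1))) = (38 * r + 2) + 2 * r := by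
    rw [finrank_real_of_complex, finrank_euclideanSpace_fin]
    ring
  -- `R` is six times the real dimension, so Markov's inequality loses at most `1/6`. The squared
  -- radius is `R / 72`, and `t = 6` suffices in the Chernoff bound.
  have key := A.mul_stdGaussian_le B.signal B.decode (√((20 * r + 1 : ℝ) / 6)) r
    B.measurable_signal B.continuous_decode (P := P) (t := 6) (by norm_num) hdim
    (R := 12 * (20 * r + 1)) (by positivity) (p := 2 / 3) fun c hc => by
      refine (hsolve (B.input c) 0 h𝒩).trans (measure_mono ?_)
      have hf : (fun t => FourierInterp.invFourier μ (B.input c) t + (0 : ℝ → ℂ) t) =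
          B.signal c := by
        rw [← B.invFourier_input c]
        simp
      rintro ω ⟨k, hk, hrec⟩
      obtain ⟨k', hk', hs⟩ := hquery (B.input c) 0 h𝒩 ω
      rw [hf] at hk hrec hs
      -- The success event does not bound `k`; uniqueness of the halting time identifies it with `k'
      -- ≤ r`.
      obtain rfl := FourierInterp.QueryAlgorithm.StopsAfter.eq A hk hs
        (le_max_left k k') (le_max_right k k') rfl
      refine ⟨k, hk', hk, ?_⟩
      rw [dist_eq_norm]
      refine Real.le_sqrt_of_sq_le ((B.norm_sq_sub_decode_le_of_recovers hε hrec).trans ?_)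
      linarith
  refine absurd key (not_le.2 ?_)
  convert FourierInterp.two_thirds_mul_gaussian_bound_lt r using 4
  rw [hdim]
  push_cast
  ring
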